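/- For a permutation $w = w_1 w_2 \cdots w_n \in \mathfrak{S}_n$, let $\mathrm{as}(w)$ be the largest $k$ for which there are indices $i_1 < i_2 < \cdots < i_k$ with $w_{i_1} > w_{i_2} < w_{i_3} > w_{i_4} < \cdots w_{i_k}$ (the length of the longest alternating subsequence of $w$; an alternating sequence with at least two terms must begin with a descent). For $j \ge 0$ let $$\nu_j(n) = \frac{1}{n!}\sum_{w \in \mathfrak{S}_n} \mathrm{as}(w)\,(\mathrm{as}(w)-1)\cdots(\mathrm{as}(w)-j+1)$$ be the $j$-th factorial moment, and let $\mathrm{var}(\mathrm{as}_n)$ be the variance of $\mathrm{as}(w)$ when $w$ is chosen uniformly at random from $\mathfrak{S}_n$. Then $\mathrm{var}(\mathrm{as}_n) = \nu_2(n) + \nu_1(n) - \nu_1(n)^2$ for all $n\ge 0$, and for all $n \ge 4$ $$\nu_2(n) = \frac{40n^2 - 24n - 19}{90}, \qquad \mathrm{var}(\mathrm{as}_n) = \frac{32n - 13}{180} = \frac{8}{45}\,n - \frac{13}{180}.$$ -/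

import Mathlib

/-!
Put `as(w) = 1 + X(w)`. Then `X` counts the steps at which the word `w` changes direction, where `w`
is regarded as ascending before its first letter: the last letters of the maximal monotone runs form
an alternating subsequence, and the word itself must change direction between two consecutive steps
of any alternating subsequence.

Thus `X` is a sum of indicators, each depending on the relative order of at most three consecutive
letters. The relative order of the letters in a window of positions is uniformly distributed and
independent of the letters outside the window, so the first two moments of `X` follow by recursion
on the number of letters from a few averages over `𝔖₂`, `𝔖₃`, `𝔖₄` and `𝔖₅`. Consecutive indicators
interact up to distance two, so the recursion for the second moment starts at `n = 4`.
-/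

open MeasureTheory ProbabilityTheory

/-- A finite sequence `v 0, v 1, …, v (k-1)` is alternating if
`v 0 > v 1 < v 2 > v 3 < ⋯`; a sequence of length at least two begins with a descent. -/
def IsAlternating {k n : ℕ} (v : Fin k → Fin n) : Prop :=
  ∀ i j : Fin k, (i : ℕ) + 1 = (j : ℕ) →
    (Even (i : ℕ) → v j < v i) ∧ (Odd (i : ℕ) → v i < v j)

/-- The permutation `w`, read as the word `w 0, w 1, …, w (n-1)`, has an alternating
subsequence with `k` terms, at the positions `p 0 < p 1 < ⋯ < p (k-1)`. -/
def HasAlternatingSubseq {n : ℕ} (w : Equiv.Perm (Fin n)) (k : ℕ) : Prop :=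
  ∃ p : Fin k → Fin n, StrictMono p ∧ IsAlternating (fun i => w (p i))

/-- The number of terms of the longest alternating subsequence of `w`. -/
noncomputable def longestAlternating {n : ℕ} (w : Equiv.Perm (Fin n)) : ℕ :=
  sSup {k : ℕ | HasAlternatingSubseq w k}

theorem HasAlternatingSubseq.le {n k : ℕ} {w : Equiv.Perm (Fin n)}
    (h : HasAlternatingSubseq w k) : k ≤ n := by
  obtain ⟨p, hp, -⟩ := h
  simpa using Fintype.card_le_of_injective p hp.injective

/-- The set of lengths is nonempty and bounded, so the supremum above is a maximum. -/
theorem isGreatest_longestAlternating {n : ℕ} (w : Equiv.Perm (Fin n)) :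
    IsGreatest {k : ℕ | HasAlternatingSubseq w k} (longestAlternating w) := by
  have hb : BddAbove {k : ℕ | HasAlternatingSubseq w k} := ⟨n, fun _ h => h.le⟩
  have hne : {k : ℕ | HasAlternatingSubseq w k}.Nonempty :=
    ⟨0, Fin.elim0, fun i => i.elim0, fun i => i.elim0⟩
  exact ⟨Nat.sSup_mem hne hb, fun _ h => le_csSup hb h⟩

/-- The factorial moment `ν_j(n) = (1/n!) ∑_w as(w) (as(w) - 1) ⋯ (as(w) - j + 1)`. -/
noncomputable def factorialMoment (j n : ℕ) : ℝ :=
  (∑ w : Equiv.Perm (Fin n), ((longestAlternating w).descFactorial j : ℝ)) / (n.factorial : ℝ)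

/-- The variance of the random variable `as_n`, the length of the longest alternating
subsequence of a uniformly distributed random permutation. -/
noncomputable def varianceLongestAlternating (n : ℕ) : ℝ :=
  letI : MeasurableSpace (Equiv.Perm (Fin n)) := ⊤
  variance (fun w : Equiv.Perm (Fin n) => (longestAlternating w : ℝ))
    (PMF.uniformOfFintype (Equiv.Perm (Fin n))).toMeasure

open Finset
open scoped BigOperators

/-! ### Changes of direction -/

/-- The `i`-th entry tells whether the word `v` descends from `v i` to `v (i + 1)`. -/
def descent {α : Type*} [LinearOrder α] (v : ℕ → α) (i : ℕ) : Bool :=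
  decide (v (i + 1) < v i)

/-- The indicator that a word with descents `d` changes direction at its `i`-th letter, where the
word is regarded as ascending before its first letter. -/
def turn (d : ℕ → Bool) : ℕ → ℕ
  | 0 => (d 0).toNat
  | i + 1 => (d i ^^ d (i + 1)).toNat

/-- The number of changes of direction in the first `m` steps of a word with descents `d`. -/
def turnCount (d : ℕ → Bool) (m : ℕ) : ℕ :=
  ∑ i ∈ range m, turn d i

theorem turnCount_succ (d : ℕ → Bool) (m : ℕ) : turnCount d (m + 1) = turnCount d m + turn d m :=
  sum_range_succ _ _

theorem turn_le_one (d : ℕ → Bool) (i : ℕ) : turn d i ≤ 1 := by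
  cases i <;> exact Bool.toNat_le _

theorem turnCount_mono (d : ℕ → Bool) : Monotone (turnCount d) := fun _ _ h =>
  sum_le_sum_of_subset (range_subset_range.mpr h)

theorem odd_turnCount_succ (d : ℕ → Bool) (m : ℕ) : Odd (turnCount d (m + 1)) ↔ d m = true := by
  induction m with
  | zero => cases h : d 0 <;> simp [turnCount, turn, h]
  | succ m ih =>
    rw [turnCount_succ, Nat.odd_add, ih]
    cases h : d m <;> cases h' : d (m + 1) <;> simp [turn, h, h']

theorem dependsOn_turn {i k : ℕ} (hik : i < k) : DependsOn (fun d => turn d i) (Set.Iio k) := by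
  intro d d' h
  cases i with
  | zero => exact congrArg Bool.toNat (h 0 hik)
  | succ i => simp only [turn, h i (i.lt_succ_self.trans hik), h (i + 1) hik]

theorem dependsOn_turnCount (m : ℕ) : DependsOn (fun d => turnCount d m) (Set.Iio m) :=
  fun _ _ h => sum_congr rfl fun _ hi => dependsOn_turn (mem_range.mp hi) h

section Runs

variable {α : Type*} [LinearOrder α] {v : ℕ → α} {a b : ℕ}

theorem odd_turnCount_descent_succ (v : ℕ → α) (s : ℕ) :
    Odd (turnCount (descent v) (s + 1)) ↔ v (s + 1) < v s :=
  (odd_turnCount_succ _ s).trans decide_eq_true_iff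

theorem monotoneOn_of_even_turnCount
    (h : ∀ s ∈ Set.Ico a b, Even (turnCount (descent v) (s + 1))) :
    MonotoneOn v (Set.Icc a b) := by
  refine monotoneOn_of_le_add_one Set.ordConnected_Icc fun s _ hs hs' => ?_
  rw [← not_lt, ← odd_turnCount_descent_succ, Nat.not_odd_iff_even]
  exact h s ⟨hs.1, hs'.2⟩

theorem antitoneOn_of_odd_turnCount
    (h : ∀ s ∈ Set.Ico a b, Odd (turnCount (descent v) (s + 1))) :
    AntitoneOn v (Set.Icc a b) := by
  refine antitoneOn_of_add_one_le Set.ordConnected_Icc fun s _ hs hs' => ?_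
  exact ((odd_turnCount_descent_succ v s).mp (h s ⟨hs.1, hs'.2⟩)).le

end Runs

/-! ### The longest alternating subsequence -/

theorem IsAlternating.le_turnCount {k n : ℕ} {v : ℕ → Fin n} {p : Fin k → ℕ}
    (h : IsAlternating (v ∘ p)) (hp : StrictMono p) (i : Fin k) :
    (i : ℕ) ≤ turnCount (descent v) (p i) := by
  obtain ⟨i, hi⟩ := i
  induction i with
  | zero => exact Nat.zero_le _
  | succ i ih =>
    specialize ih (by omega)
    set a := p ⟨i, by omega⟩
    set b := p ⟨i + 1, hi⟩
    have hab : a ≤ b := hp.monotone (Fin.mk_le_mk.mpr i.le_succ)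
    have hstep : (Even i → v b < v a) ∧ (Odd i → v a < v b) := h ⟨i, by omega⟩ ⟨i + 1, hi⟩ rfl
    by_contra! hlt
    have hconst : ∀ s ∈ Set.Ico a b, turnCount (descent v) (s + 1) = i := fun s hs => by
      have := turnCount_mono (descent v) (show a ≤ s + 1 from hs.1.trans s.le_succ)
      have := turnCount_mono (descent v) (show s + 1 ≤ b from hs.2)
      change i ≤ _ at ih
      change _ < i + 1 at hlt
      omega
    rcases i.even_or_odd with heven | hodd
    · have hmono : MonotoneOn v (Set.Icc a b) :=
        monotoneOn_of_even_turnCount fun s hs => (hconst s hs).symm ▸ heven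
      exact (hmono ⟨le_rfl, hab⟩ ⟨hab, le_rfl⟩ hab).not_gt (hstep.1 heven)
    · have hanti : AntitoneOn v (Set.Icc a b) :=
        antitoneOn_of_odd_turnCount fun s hs => (hconst s hs).symm ▸ hodd
      exact (hanti ⟨le_rfl, hab⟩ ⟨hab, le_rfl⟩ hab).not_gt (hstep.2 hodd)

/-- The last position, among `0, …, n`, of the `j`-th maximal monotone run of a word with
descents `d`; the `0`-th run is ascending and may consist of a single letter. -/
def runEnd (d : ℕ → Bool) (n j : ℕ) : ℕ :=
  Nat.findGreatest (fun m => turnCount d m ≤ j) n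

theorem runEnd_le (d : ℕ → Bool) (n j : ℕ) : runEnd d n j ≤ n :=
  Nat.findGreatest_le n

theorem turnCount_runEnd_le (d : ℕ → Bool) (n j : ℕ) : turnCount d (runEnd d n j) ≤ j :=
  Nat.findGreatest_spec (P := fun m => turnCount d m ≤ j) n.zero_le (by simp [turnCount])

theorem runEnd_lt_runEnd_succ {d : ℕ → Bool} {n j : ℕ} (hj : j < turnCount d n) :
    runEnd d n j < runEnd d n (j + 1) := by
  have hle := turnCount_runEnd_le d n j
  have hlt : runEnd d n j < n := (turnCount_mono d).reflect_lt (hle.trans_lt hj)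
  refine Nat.le_findGreatest hlt ?_
  rw [Nat.succ_eq_add_one, turnCount_succ]
  exact Nat.add_le_add hle (turn_le_one d _)

theorem strictMonoOn_runEnd (d : ℕ → Bool) (n : ℕ) :
    StrictMonoOn (runEnd d n) (Set.Iic (turnCount d n)) :=
  strictMonoOn_Iic_of_lt_succ fun _ => runEnd_lt_runEnd_succ

theorem turnCount_succ_eq_of_mem_run {d : ℕ → Bool} {n j s : ℕ}
    (hs : s ∈ Set.Ico (runEnd d n j) (runEnd d n (j + 1))) : turnCount d (s + 1) = j + 1 := by
  have hle : turnCount d (s + 1) ≤ j + 1 :=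
    (turnCount_mono d (Nat.succ_le_of_lt hs.2)).trans (turnCount_runEnd_le d n (j + 1))
  have hgt : ¬ turnCount d (s + 1) ≤ j :=
    Nat.findGreatest_is_greatest (P := fun m => turnCount d m ≤ j) (Nat.lt_succ_of_le hs.1)
      ((Nat.succ_le_of_lt hs.2).trans (runEnd_le d n (j + 1)))
  omega

theorem isAlternating_runEnd {n l : ℕ} {v : ℕ → Fin l} (hv : Set.InjOn v (Set.Iic n)) :
    IsAlternating fun i : Fin (turnCount (descent v) n + 1) => v (runEnd (descent v) n i) := by
  rintro ⟨i, hi⟩ ⟨_, hi'⟩ rfl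
  set a := runEnd (descent v) n i
  set b := runEnd (descent v) n (i + 1)
  have hab : a < b := runEnd_lt_runEnd_succ (Nat.lt_of_succ_lt_succ hi')
  have hne : v a ≠ v b := hv.ne (runEnd_le _ _ _) (runEnd_le _ _ _) hab.ne
  have hrun : ∀ s ∈ Set.Ico a b, turnCount (descent v) (s + 1) = i + 1 :=
    fun _ => turnCount_succ_eq_of_mem_run
  refine ⟨fun heven => ?_, fun hodd => ?_⟩
  · have hanti : AntitoneOn v (Set.Icc a b) :=
      antitoneOn_of_odd_turnCount fun s hs => (hrun s hs).symm ▸ heven.add_one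
    exact (hanti ⟨le_rfl, hab.le⟩ ⟨hab.le, le_rfl⟩ hab.le).lt_of_ne hne.symm
  · have hmono : MonotoneOn v (Set.Icc a b) :=
      monotoneOn_of_even_turnCount fun s hs => (hrun s hs).symm ▸ hodd.add_one
    exact (hmono ⟨le_rfl, hab.le⟩ ⟨hab.le, le_rfl⟩ hab.le).lt_of_ne hne

theorem strictMonoOn_finOfNat (n : ℕ) : StrictMonoOn (Fin.ofNat (n + 1)) (Set.Iic n) := by
  intro a ha b hb hab
  rwa [Fin.lt_def, Fin.val_ofNat, Fin.val_ofNat, Nat.mod_eq_of_lt (Nat.lt_succ_of_le ha),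
    Nat.mod_eq_of_lt (Nat.lt_succ_of_le hb)]

/-- A finite word as a sequence indexed by `ℕ`, continued periodically. -/
def word {n : ℕ} {α : Type*} (u : Fin (n + 1) → α) : ℕ → α :=
  u ∘ Fin.ofNat (n + 1)

theorem longestAlternating_eq_turnCount {n : ℕ} (w : Equiv.Perm (Fin (n + 1))) :
    longestAlternating w = turnCount (descent (word w)) n + 1 := by
  refine (isGreatest_longestAlternating w).unique ⟨?_, ?_⟩
  · have hword : Set.InjOn (word w) (Set.Iic n) :=
      w.injective.comp_injOn (strictMonoOn_finOfNat n).injOn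
    refine ⟨fun i => Fin.ofNat (n + 1) (runEnd (descent (word w)) n i), fun i j hij => ?_,
      isAlternating_runEnd hword⟩
    exact strictMonoOn_finOfNat n (runEnd_le _ _ _) (runEnd_le _ _ _)
      (strictMonoOn_runEnd _ n (Nat.le_of_lt_succ i.isLt) (Nat.le_of_lt_succ j.isLt) hij)
  · rintro (_ | k) ⟨p, hp, halt⟩
    · exact Nat.zero_le _
    have hval : (fun i => w (p i)) = word w ∘ fun i => (p i : ℕ) := by
      funext i
      simp [word]
    rw [hval] at halt
    have hlast := halt.le_turnCount (fun _ _ hij => hp hij) (Fin.last k)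
    exact Nat.succ_le_succ (hlast.trans (turnCount_mono _ (Nat.le_of_lt_succ (p _).isLt)))

/-! ### Standardization -/

section Standardization

variable {k : ℕ} {α : Type*} [LinearOrder α]

/-- The standardization of a word `u` with distinct letters: the permutation whose letters are in
the same relative order as those of `u`. -/
def standardize (u : Fin k → α) : Equiv.Perm (Fin k) :=
  (Tuple.sort u)⁻¹

theorem standardize_lt_standardize_iff {u : Fin k → α} (hu : Function.Injective u) (a b : Fin k) :
    standardize u a < standardize u b ↔ u a < u b := by
  have hmono : StrictMono (u ∘ Tuple.sort u) :=
    (Tuple.monotone_sort u).strictMono_of_injective (hu.comp (Tuple.sort u).injective)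
  simpa [standardize] using
    (hmono.lt_iff_lt (a := (Tuple.sort u)⁻¹ a) (b := (Tuple.sort u)⁻¹ b)).symm

theorem standardize_comp_perm {u : Fin k → α} (hu : Function.Injective u)
    (τ : Equiv.Perm (Fin k)) : standardize (u ∘ τ) = standardize u * τ := by
  have hsort : u ∘ ⇑(τ * Tuple.sort (u ∘ τ)) = u ∘ Tuple.sort u :=
    Tuple.unique_monotone (Tuple.monotone_sort (u ∘ τ)) (Tuple.monotone_sort u)
  have hperm : τ * Tuple.sort (u ∘ τ) = Tuple.sort u :=
    DFunLike.coe_injective (hu.comp_left hsort)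
  rw [standardize, standardize, ← hperm]
  group

/-- Permuting the entries of `w` at the positions in the range of `p` by `τ` does not affect `G` and
multiplies the standardization by `τ`; averaging over `τ` decouples the two factors. -/
theorem expect_standardize_mul [Fintype α] {R : Type*} [Semifield R] [CharZero R]
    (p : Fin k ↪ α) (F : Equiv.Perm (Fin k) → R) {G : (α → α) → R}
    (hG : DependsOn G (Set.range p)ᶜ) :
    𝔼 w : Equiv.Perm α, F (standardize (w ∘ p)) * G w =
      (𝔼 σ, F σ) * 𝔼 w : Equiv.Perm α, G w := by
  have hshift (τ : Equiv.Perm (Fin k)) :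
      𝔼 w : Equiv.Perm α, F (standardize (w ∘ p)) * G w =
        𝔼 w : Equiv.Perm α, F (standardize (w ∘ p) * τ) * G w := by
    symm
    refine Fintype.expect_equiv (Equiv.mulRight (τ.viaFintypeEmbedding p)) _ _ fun w => ?_
    have hp : ⇑(w * τ.viaFintypeEmbedding p) ∘ p = (w ∘ p) ∘ τ := by
      funext a
      simp [Equiv.Perm.viaFintypeEmbedding_apply_image]
    have hG' : G ⇑(w * τ.viaFintypeEmbedding p) = G w := hG fun x hx => by
      simp [Equiv.Perm.viaFintypeEmbedding_apply_notMem_range _ _ hx]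
    rw [Equiv.coe_mulRight, hp, hG', standardize_comp_perm (w.injective.comp p.injective)]
  have htranslate (ρ : Equiv.Perm (Fin k)) : 𝔼 τ, F (ρ * τ) = 𝔼 σ, F σ :=
    Fintype.expect_equiv (Equiv.mulLeft ρ) _ _ fun _ => rfl
  calc 𝔼 w : Equiv.Perm α, F (standardize (w ∘ p)) * G w
      = 𝔼 τ, 𝔼 w : Equiv.Perm α, F (standardize (w ∘ p) * τ) * G w := by
        rw [← expect_congr rfl fun τ _ => hshift τ, Fintype.expect_const]
    _ = 𝔼 w : Equiv.Perm α, (𝔼 τ, F (standardize (w ∘ p) * τ)) * G w := by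
        rw [expect_comm]
        simp only [expect_mul]
    _ = (𝔼 σ, F σ) * 𝔼 w : Equiv.Perm α, G w := by
        simp only [htranslate, mul_expect]

end Standardization

/-! ### Averages over permutations -/

/-- The `k + 1` consecutive positions from `m` on. -/
def window {n m k : ℕ} (h : m + k ≤ n) : Fin (k + 1) ↪ Fin (n + 1) where
  toFun i := Fin.ofNat (n + 1) (m + i)
  inj' i j hij := by
    have := (strictMonoOn_finOfNat n).injOn (show m + (i : ℕ) ≤ n by omega)
      (show m + (j : ℕ) ≤ n by omega) hij
    omega

theorem descent_standardize_window {n m k i : ℕ} {α : Type*} [LinearOrder α]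
    {u : Fin (n + 1) → α} (hu : Function.Injective u) (h : m + k ≤ n) (hi : i < k) :
    descent (word (standardize (u ∘ window h))) i = descent (word u) (m + i) := by
  have hval (j : ℕ) (hj : j ≤ k) :
      (u ∘ window h) (Fin.ofNat (k + 1) j) = word u (m + j) := by
    simp [window, word, Nat.mod_eq_of_lt (Nat.lt_succ_of_le hj)]
  refine decide_eq_decide.mpr ?_
  rw [word, Function.comp_apply, Function.comp_apply,
    standardize_lt_standardize_iff (hu.comp (window h).injective),
    hval _ hi, hval _ hi.le, add_assoc]

theorem descent_word_congr {n i m k : ℕ} {α : Type*} [LinearOrder α] {u u' : Fin (n + 1) → α}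
    (h : m + k ≤ n) (hi : i + 1 < m) (hu : ∀ x ∈ (Set.range (window h))ᶜ, u x = u' x) :
    descent (word u) i = descent (word u') i := by
  have hword (j : ℕ) (hj : j < m) : word u j = word u' j := by
    refine hu _ ?_
    rintro ⟨a, ha⟩
    have := (strictMonoOn_finOfNat n).injOn (show m + (a : ℕ) ≤ n by omega)
      (show j ≤ n by omega) ha
    omega
  rw [descent, descent, hword i (by omega), hword (i + 1) hi]

section Semifield

variable {R : Type*} [Semifield R] [CharZero R]

theorem expect_descent_window_mul {n m k : ℕ} (h : m + k ≤ n) {F G : (ℕ → Bool) → R}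
    (hF : DependsOn F (Set.Iio k)) (hG : DependsOn G {i | i + 1 < m}) :
    𝔼 w : Equiv.Perm (Fin (n + 1)),
        F (fun i => descent (word w) (m + i)) * G (descent (word w)) =
      (𝔼 σ : Equiv.Perm (Fin (k + 1)), F (descent (word σ))) *
        𝔼 w : Equiv.Perm (Fin (n + 1)), G (descent (word w)) := by
  have hG' : DependsOn (fun u : Fin (n + 1) → Fin (n + 1) => G (descent (word u)))
      (Set.range (window h))ᶜ :=
    fun _ _ hu => hG fun _ hi => descent_word_congr h hi hu
  rw [← expect_standardize_mul (window h) (fun σ => F (descent (word σ))) hG']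
  refine expect_congr rfl fun w _ => congrArg (· * _) (hF fun i hi => ?_)
  exact (descent_standardize_window w.injective h hi).symm

theorem expect_descent_window {n m k : ℕ} (h : m + k ≤ n) {F : (ℕ → Bool) → R}
    (hF : DependsOn F (Set.Iio k)) :
    𝔼 w : Equiv.Perm (Fin (n + 1)), F (fun i => descent (word w) (m + i)) =
      𝔼 σ : Equiv.Perm (Fin (k + 1)), F (descent (word σ)) := by
  simpa using expect_descent_window_mul h hF (G := fun _ => 1) fun _ _ _ => rfl

end Semifield

theorem expect_perm_natCast (k : ℕ) (f : Equiv.Perm (Fin k) → ℕ) :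
    𝔼 σ, (f σ : ℝ) = (∑ σ, f σ : ℕ) / (k.factorial : ℝ) := by
  rw [Fintype.expect_eq_sum_div_card, Fintype.card_perm, Fintype.card_fin, Nat.cast_sum]

theorem expect_natCast_descent_window {n m k : ℕ} (h : m + k ≤ n) {f : (ℕ → Bool) → ℕ}
    (hf : DependsOn f (Set.Iio k)) :
    𝔼 w : Equiv.Perm (Fin (n + 1)), (f (fun i => descent (word w) (m + i)) : ℝ) =
      (∑ σ : Equiv.Perm (Fin (k + 1)), f (descent (word σ)) : ℕ) / ((k + 1).factorial : ℝ) := by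
  rw [← expect_perm_natCast]
  exact expect_descent_window h (F := fun d => (f d : ℝ)) fun _ _ hd => congrArg Nat.cast (hf hd)

/-! ### Moments of the number of turns -/

section Moments

variable {n m : ℕ}

theorem expect_turn_zero (h : 1 ≤ n) :
    𝔼 w : Equiv.Perm (Fin (n + 1)), (turn (descent (word w)) 0 : ℝ) = 1 / 2 := by
  have hsum : ∑ σ : Equiv.Perm (Fin 2), turn (descent (word σ)) 0 = 1 := by decide +kernel
  have hwindow := expect_natCast_descent_window (m := 0) (k := 1) (by omega)
    (dependsOn_turn zero_lt_one)
  rw [hsum] at hwindow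
  exact hwindow.trans (by norm_num [Nat.factorial])

theorem expect_turn_succ (h : m + 2 ≤ n) :
    𝔼 w : Equiv.Perm (Fin (n + 1)), (turn (descent (word w)) (m + 1) : ℝ) = 2 / 3 := by
  have hsum : ∑ σ : Equiv.Perm (Fin 3), turn (descent (word σ)) 1 = 4 := by decide +kernel
  have hwindow := expect_natCast_descent_window h (dependsOn_turn one_lt_two)
  rw [hsum] at hwindow
  exact hwindow.trans (by norm_num [Nat.factorial])

theorem expect_turn_mul_turn_add_one (h : m + 3 ≤ n) :
    𝔼 w : Equiv.Perm (Fin (n + 1)),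
      (turn (descent (word w)) (m + 1) * turn (descent (word w)) (m + 2) : ℝ) = 5 / 12 := by
  have hsum : ∑ σ : Equiv.Perm (Fin 4),
      turn (descent (word σ)) 1 * turn (descent (word σ)) 2 = 10 := by decide +kernel
  have hwindow := expect_natCast_descent_window h (f := fun d => turn d 1 * turn d 2)
    fun _ _ hd => congrArg₂ (· * ·) (dependsOn_turn (by norm_num) hd)
      (dependsOn_turn (by norm_num) hd)
  simp only [hsum, Nat.cast_mul] at hwindow
  exact hwindow.trans (by norm_num [Nat.factorial])

theorem expect_turn_mul_turn_add_two (h : m + 4 ≤ n) :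
    𝔼 w : Equiv.Perm (Fin (n + 1)),
      (turn (descent (word w)) (m + 1) * turn (descent (word w)) (m + 3) : ℝ) = 9 / 20 := by
  have hsum : ∑ σ : Equiv.Perm (Fin 5),
      turn (descent (word σ)) 1 * turn (descent (word σ)) 3 = 54 := by decide +kernel
  have hwindow := expect_natCast_descent_window h (f := fun d => turn d 1 * turn d 3)
    fun _ _ hd => congrArg₂ (· * ·) (dependsOn_turn (by norm_num) hd)
      (dependsOn_turn (by norm_num) hd)
  simp only [hsum, Nat.cast_mul] at hwindow
  exact hwindow.trans (by norm_num [Nat.factorial])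

theorem expect_turnCount_succ (h : m + 1 ≤ n) :
    𝔼 w : Equiv.Perm (Fin (n + 1)), (turnCount (descent (word w)) (m + 1) : ℝ) =
      (4 * m + 3) / 6 := by
  induction m with
  | zero =>
    simp only [turnCount, zero_add, sum_range_one, expect_turn_zero h]
    norm_num
  | succ m ih =>
    simp only [turnCount_succ _ (m + 1), Nat.cast_add, expect_add_distrib]
    rw [ih (by omega), expect_turn_succ h]
    push_cast
    ring

theorem expect_turn_mul_turnCount_of_gap (h : m + 4 ≤ n) :
    𝔼 w : Equiv.Perm (Fin (n + 1)),
      (turn (descent (word w)) (m + 3) * turnCount (descent (word w)) (m + 1) : ℝ) =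
      2 / 3 * ((4 * m + 3) / 6) := by
  have hF : DependsOn (fun d => (turn d 1 : ℝ)) (Set.Iio 2) := fun _ _ hd =>
    congrArg Nat.cast (dependsOn_turn one_lt_two hd)
  have hG : DependsOn (fun d => (turnCount d (m + 1) : ℝ)) {i | i + 1 < m + 2} := fun _ _ hd =>
    congrArg Nat.cast (dependsOn_turnCount (m + 1) fun i hi => hd i (Nat.succ_lt_succ hi))
  refine (expect_descent_window_mul (m := m + 2) h hF hG).trans ?_
  rw [expect_turnCount_succ (by omega), expect_turn_succ (m := 0) le_rfl]

theorem expect_turn_mul_turnCount (h : m + 4 ≤ n) :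
    𝔼 w : Equiv.Perm (Fin (n + 1)),
      (turn (descent (word w)) (m + 3) * turnCount (descent (word w)) (m + 3) : ℝ) =
      (4 * m + 3) / 9 + 13 / 15 := by
  have hexpand (d : ℕ → Bool) : (turn d (m + 3) * turnCount d (m + 3) : ℝ) =
      turn d (m + 3) * turnCount d (m + 1) + turn d (m + 1) * turn d (m + 3) +
        turn d (m + 2) * turn d (m + 3) := by
    rw [turnCount_succ, turnCount_succ]
    push_cast
    ring
  simp only [hexpand, expect_add_distrib]
  rw [expect_turn_mul_turnCount_of_gap h, expect_turn_mul_turn_add_two h,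
    expect_turn_mul_turn_add_one (m := m + 1) h]
  ring

theorem expect_turnCount_three_sq (h : 3 ≤ n) :
    𝔼 w : Equiv.Perm (Fin (n + 1)), (turnCount (descent (word w)) 3 : ℝ) ^ 2 = 4 := by
  have hsum : ∑ σ : Equiv.Perm (Fin 4), turnCount (descent (word σ)) 3 ^ 2 = 96 := by
    decide +kernel
  have hwindow := expect_natCast_descent_window (m := 0) (k := 3) (by omega)
    (f := fun d => turnCount d 3 ^ 2) fun _ _ hd => congrArg (· ^ 2) (dependsOn_turnCount 3 hd)
  simp only [hsum, Nat.cast_pow, zero_add] at hwindow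
  exact hwindow.trans (by norm_num [Nat.factorial])

theorem expect_turnCount_sq (h : m + 3 ≤ n) :
    𝔼 w : Equiv.Perm (Fin (n + 1)), (turnCount (descent (word w)) (m + 3) : ℝ) ^ 2 =
      (20 * m ^ 2 + 118 * m + 180) / 45 := by
  induction m with
  | zero => simpa using (expect_turnCount_three_sq h).trans (by norm_num)
  | succ m ih =>
    have hexpand (d : ℕ → Bool) : (turnCount d (m + 3 + 1) : ℝ) ^ 2 =
        (turnCount d (m + 3) : ℝ) ^ 2 + 2 * (turn d (m + 3) * turnCount d (m + 3)) +
          turn d (m + 3) := by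
      have hidem : (turn d (m + 3) : ℝ) ^ 2 = turn d (m + 3) := by
        rcases Nat.le_one_iff_eq_zero_or_eq_one.mp (turn_le_one d (m + 3)) with h | h <;> simp [h]
      rw [turnCount_succ, Nat.cast_add, add_sq, hidem]
      ring
    rw [add_right_comm]
    simp only [hexpand, expect_add_distrib, ← mul_expect]
    rw [ih (by omega), expect_turn_mul_turnCount (by omega), expect_turn_succ (by omega)]
    push_cast
    ring

end Moments

/-! ### Factorial moments and variance -/

theorem factorialMoment_eq_expect (j n : ℕ) :
    factorialMoment j n =
      𝔼 w : Equiv.Perm (Fin n), ((longestAlternating w).descFactorial j : ℝ) := by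
  rw [factorialMoment, Fintype.expect_eq_sum_div_card, Fintype.card_perm, Fintype.card_fin]

theorem factorialMoment_one_eq {n : ℕ} (h : 2 ≤ n) : factorialMoment 1 n = (4 * n + 1) / 6 := by
  obtain ⟨m, rfl⟩ := Nat.exists_eq_add_of_le' h
  simp only [factorialMoment_eq_expect, longestAlternating_eq_turnCount, Nat.descFactorial_one,
    Nat.cast_add_one, expect_add_distrib, Fintype.expect_const]
  rw [expect_turnCount_succ le_rfl]
  ring

theorem factorialMoment_two_eq {n : ℕ} (h : 4 ≤ n) :
    factorialMoment 2 n = (40 * (n : ℝ) ^ 2 - 24 * n - 19) / 90 := by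
  obtain ⟨m, rfl⟩ := Nat.exists_eq_add_of_le' h
  have hexpand (X : ℕ) : (((X + 1).descFactorial 2 : ℕ) : ℝ) = (X : ℝ) ^ 2 + X := by
    rw [Nat.cast_descFactorial_two]
    push_cast
    ring
  simp only [factorialMoment_eq_expect, longestAlternating_eq_turnCount, hexpand,
    expect_add_distrib]
  rw [expect_turnCount_sq le_rfl, expect_turnCount_succ (m := m + 2) le_rfl]
  push_cast
  ring

theorem integral_uniformOfFintype {α E : Type*} [Fintype α] [Nonempty α] [MeasurableSpace α]
    [MeasurableSingletonClass α] [NormedAddCommGroup E] [NormedSpace ℝ E] [CompleteSpace E]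
    [Module ℚ≥0 E] (f : α → E) :
    ∫ x, f x ∂(PMF.uniformOfFintype α).toMeasure = 𝔼 x, f x := by
  rw [PMF.integral_eq_sum]
  simp [← smul_sum, expect, ← NNRat.cast_smul_eq_nnqsmul ℝ]

theorem variance_uniformOfFintype {α : Type*} [Fintype α] [Nonempty α] [MeasurableSpace α]
    [MeasurableSingletonClass α] (X : α → ℝ) :
    variance X (PMF.uniformOfFintype α).toMeasure = 𝔼 x, X x ^ 2 - (𝔼 x, X x) ^ 2 := by
  rw [variance_eq_sub MemLp.of_discrete, integral_uniformOfFintype, integral_uniformOfFintype]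
  rfl

theorem varianceLongestAlternating_eq (n : ℕ) :
    varianceLongestAlternating n =
      factorialMoment 2 n + factorialMoment 1 n - factorialMoment 1 n ^ 2 := by
  let : MeasurableSpace (Equiv.Perm (Fin n)) := ⊤
  have hsq (X : ℕ) : (X : ℝ) ^ 2 = X.descFactorial 2 + X := by
    rw [Nat.cast_descFactorial_two]
    ring
  rw [varianceLongestAlternating, variance_uniformOfFintype]
  simp only [factorialMoment_eq_expect, Nat.descFactorial_one, hsq, expect_add_distrib]

theorem mainTheorem4 :
    (∀ n : ℕ, varianceLongestAlternating n =
      factorialMoment 2 n + factorialMoment 1 n - factorialMoment 1 n ^ 2) ∧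
    (∀ n : ℕ, 4 ≤ n →
      factorialMoment 2 n = (40 * (n : ℝ) ^ 2 - 24 * (n : ℝ) - 19) / 90 ∧
      varianceLongestAlternating n = (32 * (n : ℝ) - 13) / 180 ∧
      varianceLongestAlternating n = 8 / 45 * (n : ℝ) - 13 / 180) := by
  refine ⟨varianceLongestAlternating_eq, fun n hn => ?_⟩
  have hvar : varianceLongestAlternating n = (32 * (n : ℝ) - 13) / 180 := by
    rw [varianceLongestAlternating_eq, factorialMoment_two_eq hn,
      factorialMoment_one_eq (le_trans (by norm_num) hn)]
    ring
  exact ⟨factorialMoment_two_eq hn, hvar, hvar.trans (by ring)⟩
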